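/- All vector spaces are real. A set algebra is a family of subsets of some set that contains $\varnothing$ and is closed under complementation and finite unions. For a cardinal $\kappa$, a Banach space $X$ has the $\kappa$-SVM property if there is a constant $v<\infty$ such that for every set algebra $\mathcal F$ with $|\mathcal F|<\kappa$ and every map $\nu\colon\mathcal F\to X$ with $$\|\nu(A\cup B)-\nu(A)-\nu(B)\|\le 1\quad\text{for all disjoint }A,B\in\mathcal F,$$ there is a finitely additive $\mu\colon\mathcal F\to X$ with $\|\nu(A)-\mu(A)\|\le v$ for all $A\in\mathcal F$. An F-space is a topological vector space whose topology is induced by a complete translation-invariant metric (local convexity is not required). A pair $(W,X)$ of F-spaces splits if, for every F-space $Z$ containing $X$ as a (closed) subspace with $Z/X$ linearly homeomorphic to $W$, the exact sequence $0\to X\to Z\to W\to 0$ splits, i.e. there is a linear homeomorphism $T\colon Z\to X\oplus W$ that carries the inclusion of $X$ in $Z$ to the natural inclusion $X\to X\oplus W$ and the quotient map $Z\to W$ to the natural projection $X\oplus W\to W$. For a cardinal $\Gamma$, $\kappa^+$ denotes the successor cardinal, $\ell_\infty(\Gamma)$ is the space of bounded real functions on a set of cardinality $\Gamma$ with the supremum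 norm, and $c_0(\Gamma)$ is its subspace of functions $x$ such that $\{\gamma:|x(\gamma)|\ge\varepsilon\}$ is finite for all $\varepsilon>0$. **Theorem 4.2.** Let $\Gamma$ be a cardinal number and let $X$ be a Banach space. (i) If $X$ has the $(2^\Gamma)^+$-SVM property, then the pair $(\ell_\infty(\Gamma),X)$ splits. (ii) If $X$ has the $\Gamma^+$-SVM property, then the pair $(c_0(\Gamma),X)$ splits. -/

import Mathlib

open Cardinal Topology Uniformity ZeroAtInfty

universe u v w

section SetFunctions

variable {Ω : Type u} {X : Type v} [NormedAddCommGroup X]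

/-- `ν` is `1`-additive on the family `F`. Only the values of `ν` on members of `F` matter, so a
set function `F → X` is represented by a function on all subsets of `Ω`. -/
def IsOneAdditiveOn (F : Set (Set Ω)) (ν : Set Ω → X) : Prop :=
  ∀ A ∈ F, ∀ B ∈ F, Disjoint A B → ‖ν (A ∪ B) - ν A - ν B‖ ≤ 1

/-- `μ` restricts to a (finitely additive) vector measure on the family `F`. -/
def IsVectorMeasureOn (F : Set (Set Ω)) (μ : Set Ω → X) : Prop :=
  ∀ A ∈ F, ∀ B ∈ F, Disjoint A B → μ (A ∪ B) = μ A + μ B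

end SetFunctions

/-- The `κ`-SVM property of `X`. The underlying sets `Ω` range over the universe of `κ`. This loses
no set algebra: an algebra `F` with fewer than `κ` members is isomorphic to its trace on a set which
contains one point of each nonempty member of `F`, and that set has fewer than `κ` points. -/
def HasSVMProperty (κ : Cardinal.{u}) (X : Type v) [NormedAddCommGroup X] : Prop :=
  ∃ c : ℝ, ∀ (Ω : Type u) (F : Set (Set Ω)), MeasureTheory.IsSetAlgebra F → #F < κ →
    ∀ ν : Set Ω → X, IsOneAdditiveOn F ν →
      ∃ μ : Set Ω → X, IsVectorMeasureOn F μ ∧ ∀ A ∈ F, ‖ν A - μ A‖ ≤ c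

/-- The real topological vector space `Z` is an F-space: Hausdorff, completely metrizable by a
translation-invariant metric. This is phrased through the canonical (additive group) uniformity:
a Hausdorff topological group with countably generated uniformity has a translation-invariant
metric inducing it. Local convexity is not required. -/
class IsFSpace (Z : Type w) [AddCommGroup Z] [Module ℝ Z] [UniformSpace Z] : Prop where
  isUniformAddGroup : IsUniformAddGroup Z
  continuousSMul : ContinuousSMul ℝ Z
  t2Space : T2Space Z
  isCountablyGenerated : (𝓤 Z).IsCountablyGenerated
  completeSpace : CompleteSpace Z

attribute [instance] IsFSpace.isUniformAddGroup IsFSpace.continuousSMul IsFSpace.t2Space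
  IsFSpace.isCountablyGenerated IsFSpace.completeSpace

section Splitting

variable {X : Type u} [AddCommGroup X] [Module ℝ X] [TopologicalSpace X]
  {Y : Type v} [AddCommGroup Y] [Module ℝ Y] [TopologicalSpace Y]
  {Z : Type w} [AddCommGroup Z] [Module ℝ Z] [TopologicalSpace Z]

/-- The sequence `0 → Y → Z → X → 0` with maps `i` and `q` is equivalent to the trivial sequence
`0 → Y → Y ⊕ X → X → 0`. -/
def SequenceSplits (i : Y →L[ℝ] Z) (q : Z →L[ℝ] X) : Prop :=
  ∃ T : Z ≃L[ℝ] Y × X, (∀ y, T (i y) = (y, 0)) ∧ ∀ z, (T z).2 = q z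

end Splitting

/-- The pair `(X, Y)` splits: whenever `Z` is an F-space containing (a linearly homeomorphic copy
`N` of) `Y` such that `Z ⧸ N` is linearly homeomorphic to `X`, the resulting exact sequence
`0 → Y → Z → X → 0` splits. The spaces `Z` range over the universe `w`, which is arbitrary
(every such `Z` is in bijection with `Y × X`, so `w = max u v` exhausts them). -/
def PairSplits (X : Type u) [AddCommGroup X] [Module ℝ X] [TopologicalSpace X]
    (Y : Type v) [AddCommGroup Y] [Module ℝ Y] [TopologicalSpace Y] : Prop :=
  ∀ (Z : Type w) [AddCommGroup Z] [Module ℝ Z] [UniformSpace Z] [IsFSpace Z]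
    (N : Submodule ℝ Z) (j : Y ≃L[ℝ] N) (e : (Z ⧸ N) ≃L[ℝ] X),
    SequenceSplits (N.subtypeL ∘L (j : Y →L[ℝ] N)) ((e : (Z ⧸ N) →L[ℝ] X) ∘L N.mkQL)

/-! Let `0 → X → Z → W → 0` be the sequence, with quotient map `q`, and let `φ : F → W` be a bounded
additive set function built from indicators. It has two lifts to `Z`: a bounded one `s`, since `q`
is open, and an additive one `ℓ ∘ φ`, with `ℓ` a linear, possibly discontinuous, right inverse of
`q`. Their difference takes values in `X`, and its additivity defect is that of `s`, hence bounded.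
After rescaling, the SVM property supplies an `X`-valued measure near this difference; adding it to
`ℓ ∘ φ` gives a lift `L` that is both additive and bounded (`HasSVMProperty.exists_lift`).

Extended linearly to simple functions, `L` is a section of `q` on a dense subspace, and it remains
to bound it on the unit ball. As `Z` need not be locally convex, convexity cannot be used. However,
`Z` is locally bounded (`exists_balanced_isVonNBounded_nhds`), and there bounded subsums force
bounded sums with coefficients in `[-1, 1]` (`exists_sum_smul_mem_smul`). The section then extends
continuously to `W`.

For `ℓ_∞(Γ)` the algebra is the power set. For `c₀(Γ)` with `Γ` infinite it is the finite-cofinite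
algebra, which has only `#Γ` members. -/

open Bornology Pointwise Filter

/-! ### Bounded multiplier sums in locally bounded spaces. -/

section BoundedSums

variable {Z : Type*} [AddCommGroup Z] [Module ℝ Z] [TopologicalSpace Z]

theorem exists_add_mem_smul_of_isVonNBounded [ContinuousAdd Z] {B : Set Z}
    (hB0 : B ∈ 𝓝 (0 : Z)) (hBb : IsVonNBounded ℝ B) :
    ∃ C : ℝ, 1 ≤ C ∧ ∀ t : ℝ, ∀ x ∈ t • B, ∀ y ∈ t • B, x + y ∈ (C * t) • B := by
  obtain ⟨r, hr⟩ := ((hBb.add hBb) hB0).exists_pos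
  refine ⟨max r 1, le_max_right _ _, ?_⟩
  rintro t _ ⟨x, hx, rfl⟩ _ ⟨y, hy, rfl⟩
  have h := hr.2 (max r 1) (by
    rw [Real.norm_of_nonneg (le_trans zero_le_one (le_max_right _ _))]
    exact le_max_left _ _) (Set.add_mem_add hx hy)
  obtain ⟨b, hb, hbe⟩ := h
  refine ⟨b, hb, ?_⟩
  simp only at hbe ⊢
  rw [mul_comm, mul_smul, hbe, smul_add]

theorem exists_sum_range_mem_smul [ContinuousAdd Z] {B : Set Z} (hB : Balanced ℝ B)
    (hB0 : B ∈ 𝓝 (0 : Z)) (hBb : IsVonNBounded ℝ B) (n : ℕ) :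
    ∃ K : ℝ, 1 ≤ K ∧ ∀ y : ℕ → Z, (∀ k, y k ∈ B) → ∑ k ∈ Finset.range n, y k ∈ K • B := by
  obtain ⟨C, hC1, hC⟩ := exists_add_mem_smul_of_isVonNBounded hB0 hBb
  induction n with
  | zero =>
    refine ⟨1, le_rfl, fun y _ => ?_⟩
    simpa using mem_of_mem_nhds hB0
  | succ n ih =>
    obtain ⟨K, hK1, hK⟩ := ih
    refine ⟨C * K, by nlinarith, fun y hy => ?_⟩
    rw [Finset.sum_range_succ]
    refine hC K _ (hK y hy) _ ?_
    have h1 : (1 : ℝ) • B ⊆ K • B :=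
      hB.smul_mono (by rw [norm_one, Real.norm_of_nonneg (by linarith)]; exact hK1)
    exact h1 (by simpa using hy n)

/-- In a locally bounded space, a family all of whose finite subsums are bounded is bounded
multiplier summable, with a uniform bound. -/
theorem exists_sum_smul_mem_smul [ContinuousAdd Z] {B : Set Z} (hB : Balanced ℝ B)
    (hB0 : B ∈ 𝓝 (0 : Z)) (hBb : IsVonNBounded ℝ B) :
    ∃ K : ℝ, ∀ (I : Type v) (s : Finset I) (z : I → Z) (c : I → ℝ),
      (∀ J ⊆ s, ∑ i ∈ J, z i ∈ B) → (∀ i ∈ s, |c i| ≤ 1) → ∑ i ∈ s, c i • z i ∈ K • B := by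
  obtain ⟨C, hC1, hC⟩ := exists_add_mem_smul_of_isVonNBounded hB0 hBb
  -- With `M ≥ 2 * C`, dividing by `M` more than pays for one addition: `C * t / M ≤ t / 2`.
  obtain ⟨M, hM⟩ := exists_nat_ge (2 * C)
  have hM0 : (0 : ℝ) < M := by linarith
  obtain ⟨K, hK1, hK⟩ := exists_sum_range_mem_smul hB hB0 hBb M
  have hmono : ∀ {a b : ℝ}, 0 ≤ a → a ≤ b → a • B ⊆ b • B := fun ha hab =>
    hB.smul_mono (by rwa [Real.norm_of_nonneg ha, Real.norm_of_nonneg (ha.trans hab)])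
  refine ⟨C * K, fun I s z c hz hc => ?_⟩
  classical
  let H : ℝ → Prop := fun t => ∀ c : I → ℝ, (∀ i ∈ s, 0 ≤ c i ∧ c i ≤ 1) →
    ∑ i ∈ s, c i • z i ∈ t • B
  -- This bound may depend on `s` and `z`; it only starts the halving, which ends at the uniform
  -- `K`.
  have hfin : ∃ t, 1 ≤ t ∧ H t := by
    have : ∀ J ⊆ s, ∃ t : ℝ, 1 ≤ t ∧ ∀ c : I → ℝ, (∀ i ∈ s, 0 ≤ c i ∧ c i ≤ 1) →
        ∑ i ∈ J, c i • z i ∈ t • B := by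
      intro J
      induction J using Finset.induction_on with
      | empty =>
        intro _
        exact ⟨1, le_rfl, fun c _ => by simpa using mem_of_mem_nhds hB0⟩
      | insert a J ha ih =>
        intro hJ
        obtain ⟨t, ht1, ht⟩ := ih ((Finset.subset_insert _ _).trans hJ)
        have has : a ∈ s := hJ (Finset.mem_insert_self _ _)
        refine ⟨C * t, by nlinarith, fun c hc => ?_⟩
        rw [Finset.sum_insert ha]
        refine hC t _ (hmono zero_le_one ht1 ?_) _ (ht c hc)
        rw [one_smul]
        refine hB.smul_mem (by rw [Real.norm_of_nonneg (hc a has).1]; exact (hc a has).2) ?_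
        simpa using hz {a} (by simpa using has)
    exact this s subset_rfl
  have hstep : ∀ t, K ≤ t → H t → H (t / 2) := by
    intro t hKt ht c hc
    -- Split `M * c i` into integer and fractional parts. The fractional parts are again
    -- coefficients in `[0, 1]`, so `H t` applies to them; the integer parts form a sum of `M`
    -- subsums of the family, controlled by `K`.
    let d : I → ℕ := fun i => ⌊(M : ℝ) * c i⌋₊
    have hd : ∀ i ∈ s, d i ≤ M := fun i hi => by
      refine Nat.floor_le_of_le ?_
      nlinarith [(hc i hi).2]
    have hr := ht (fun i => M * c i - d i) (fun i hi => by
      have h0 : 0 ≤ (M : ℝ) * c i := mul_nonneg hM0.le (hc i hi).1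
      have h1 := Nat.floor_le h0
      have h2 := Nat.lt_floor_add_one ((M : ℝ) * c i)
      exact ⟨by simp only [d]; linarith, by simp only [d]; linarith⟩)
    have hds : ∑ i ∈ s, (d i : ℝ) • z i = ∑ k ∈ Finset.range M, ∑ i ∈ s with k < d i, z i := by
      simp_rw [Finset.sum_filter]
      rw [Finset.sum_comm]
      refine Finset.sum_congr rfl fun i hi => ?_
      rw [← Finset.sum_filter, Finset.sum_const, Nat.cast_smul_eq_nsmul]
      congr 1
      have : (Finset.range M).filter (fun k => k < d i) = Finset.range (d i) := by
        ext k
        simp only [Finset.mem_filter, Finset.mem_range]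
        have := hd i hi
        omega
      rw [this, Finset.card_range]
    have hd' : ∑ i ∈ s, (d i : ℝ) • z i ∈ t • B := by
      rw [hds]
      exact hmono (by linarith) hKt (hK _ fun k => hz _ (Finset.filter_subset _ _))
    have hsum := hC t _ hd' _ hr
    rw [← Finset.sum_add_distrib] at hsum
    have he : ∑ i ∈ s, ((d i : ℝ) • z i + ((M : ℝ) * c i - d i) • z i)
        = (M : ℝ) • ∑ i ∈ s, c i • z i := by
      rw [Finset.smul_sum]
      refine Finset.sum_congr rfl fun i _ => ?_
      rw [← add_smul, smul_smul]
      congr 1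
      ring
    rw [he] at hsum
    have h3 : ∑ i ∈ s, c i • z i ∈ (C * t / M) • B := by
      rw [div_eq_inv_mul, mul_smul]
      exact ⟨_, hsum, by simp only; rw [smul_smul, inv_mul_cancel₀ hM0.ne', one_smul]⟩
    refine hmono (by have : 0 ≤ t := by linarith
                     positivity) ?_ h3
    rw [div_le_div_iff₀ hM0 two_pos]
    nlinarith
  have hHK : H K := by
    obtain ⟨t, ht1, ht⟩ := hfin
    obtain ⟨n, hn⟩ := pow_unbounded_of_one_lt t (one_lt_two : (1 : ℝ) < 2)
    have hn' : H (2 ^ n * K) := fun c hc => hmono (by linarith) (by nlinarith) (ht c hc)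
    clear hn
    induction n with
    | zero => simpa using hn'
    | succ n ih =>
      refine ih ?_
      have h1 : (1 : ℝ) ≤ 2 ^ (n + 1) := one_le_pow₀ one_le_two
      have := hstep _ (by nlinarith) hn'
      rwa [show (2 : ℝ) ^ (n + 1) * K / 2 = 2 ^ n * K by ring] at this
  have hp := hHK (fun i => max (c i) 0) fun i hi =>
    ⟨le_max_right _ _, max_le (abs_le.1 (hc i hi)).2 zero_le_one⟩
  have hm := hHK (fun i => max (-c i) 0) fun i hi =>
    ⟨le_max_right _ _, max_le (by linarith [(abs_le.1 (hc i hi)).1]) zero_le_one⟩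
  have hm' : -∑ i ∈ s, max (-c i) 0 • z i ∈ K • B := (hB.smul K).neg_mem_iff.2 hm
  have := hC K _ hp _ hm'
  rw [← sub_eq_add_neg, ← Finset.sum_sub_distrib] at this
  convert this using 2 with i hi
  rw [← sub_smul]
  congr 1
  rcases le_total (c i) 0 with h | h
  · rw [max_eq_right h, max_eq_left (by linarith)]; ring
  · rw [max_eq_left h, max_eq_right (by linarith)]; ring

end BoundedSums

/-! ### Local boundedness of extensions, and lifting of set functions. -/

section Extensions

variable {X : Type*} [NormedAddCommGroup X] [NormedSpace ℝ X]
  {W : Type*} [NormedAddCommGroup W] [NormedSpace ℝ W]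
  {Z : Type*} [AddCommGroup Z] [Module ℝ Z]

theorem Bornology.IsVonNBounded.preimage_of_isInducing [TopologicalSpace Z] {i : X →L[ℝ] Z}
    (hi : IsInducing i) {S : Set Z} (hS : IsVonNBounded ℝ S) : IsVonNBounded ℝ (i ⁻¹' S) := by
  intro U hU
  rw [hi.nhds_eq_comap, map_zero] at hU
  obtain ⟨V, hV, hVU⟩ := hU
  obtain ⟨r, hr0, hr⟩ := (hS hV).exists_pos
  refine Absorbs.of_norm ⟨r, fun c hc x hx => ?_⟩
  have hc0 : c ≠ 0 := norm_pos_iff.1 (hr0.trans_le hc)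
  obtain ⟨y, hy, hxy⟩ := hr c hc hx
  refine ⟨c⁻¹ • x, hVU ?_, by simp [smul_smul, hc0]⟩
  simp only at hxy
  rw [Set.mem_preimage, map_smul, ← hxy, smul_smul, inv_mul_cancel₀ hc0, one_smul]
  exact hy

/-- Local boundedness is a three-space property. -/
theorem exists_balanced_isVonNBounded_nhds [TopologicalSpace Z] [IsTopologicalAddGroup Z]
    [ContinuousSMul ℝ Z] {i : X →L[ℝ] Z} (hi : IsInducing i) {q : Z →L[ℝ] W} (hq : IsOpenMap q)
    (hiq : ∀ z, q z = 0 → ∃ x, i x = z) :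
    ∃ B : Set Z, Balanced ℝ B ∧ B ∈ 𝓝 (0 : Z) ∧ IsVonNBounded ℝ B := by
  have hX : Metric.ball (0 : X) 1 ∈ 𝓝 (0 : X) := Metric.ball_mem_nhds _ one_pos
  rw [hi.nhds_eq_comap, map_zero] at hX
  obtain ⟨U, hU, hUX⟩ := hX
  have hUW : U ∩ q ⁻¹' Metric.ball 0 1 ∈ 𝓝 (0 : Z) :=
    inter_mem hU (q.continuous.continuousAt.preimage_mem_nhds
      (by rw [map_zero]; exact Metric.ball_mem_nhds _ one_pos))
  obtain ⟨U₁, hU₁, hU₁U⟩ := exists_nhds_zero_half hUW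
  obtain ⟨B, ⟨hB0, hB⟩, hBU⟩ := (nhds_basis_balanced ℝ Z).mem_iff.1 hU₁
  refine ⟨B, hB, hB0, fun V hV => ?_⟩
  obtain ⟨V₁, hV₁, hV₁V⟩ := exists_nhds_zero_half hV
  obtain ⟨V₂, ⟨hV₂0, hV₂⟩, hV₂V⟩ := (nhds_basis_balanced ℝ Z).mem_iff.1 (inter_mem hV₁ hB0)
  -- To absorb `b ∈ B` into `V`: modulo `X`, `a⁻¹ • b` agrees with some `v ∈ V₂`. The difference
  -- lies in `B + B ⊆ U`, so it comes from the unit ball of `X`, which `V₂` absorbs.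
  have hqV : q '' V₂ ∈ 𝓝 (0 : W) := by
    have := hq.image_mem_nhds hV₂0
    rwa [map_zero] at this
  have hqB : IsVonNBounded ℝ (q '' B) := by
    refine (NormedSpace.isVonNBounded_ball ℝ W 1).subset ?_
    rintro _ ⟨b, hb, rfl⟩
    have := hU₁U b (hBU hb) 0 (mem_of_mem_nhds hU₁)
    simpa using this.2
  have hXb : IsVonNBounded ℝ (i '' Metric.ball 0 1) :=
    (NormedSpace.isVonNBounded_ball ℝ X 1).image i
  obtain ⟨r, hr0, hr⟩ := (hqB hqV).exists_pos
  obtain ⟨r', hr0', hr'⟩ := (hXb hV₂0).exists_pos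
  set a := max r 1
  set a' := max r' 1
  have ha1 : 1 ≤ a := le_max_right _ _
  have ha1' : 1 ≤ a' := le_max_right _ _
  refine Absorbs.of_norm ⟨a * a', fun c hc b hb => ?_⟩
  have hc0 : c ≠ 0 := norm_pos_iff.1 (lt_of_lt_of_le (by positivity) hc)
  obtain ⟨_, ⟨v, hv, rfl⟩, hvb⟩ := hr a (by
    rw [Real.norm_of_nonneg (by linarith)]; exact le_max_left _ _) ⟨b, hb, rfl⟩
  simp only at hvb
  have hva : a⁻¹ • b ∈ B := hB.smul_mem (by
    rw [norm_inv, Real.norm_of_nonneg (by linarith)]; exact inv_le_one_of_one_le₀ ha1) hb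
  obtain ⟨x, hx⟩ := hiq (a⁻¹ • b - v) (by
    rw [map_sub, map_smul, ← hvb, smul_smul, inv_mul_cancel₀ (by linarith), one_smul, sub_self])
  have hxB : x ∈ Metric.ball (0 : X) 1 := by
    refine hUX ?_
    rw [Set.mem_preimage, hx, sub_eq_add_neg]
    exact (hU₁U _ (hBU hva) _ (hBU (hB.neg_mem_iff.2 (hV₂V hv).2))).1
  obtain ⟨v', hv', hvx⟩ := hr' a' (by
    rw [Real.norm_of_nonneg (by linarith)]; exact le_max_left _ _) ⟨x, hxB, rfl⟩
  simp only at hvx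
  have hbe : b = a • v + (a * a') • v' := by
    rw [mul_smul, hvx, hx, ← smul_add, add_sub_cancel, smul_smul,
      mul_inv_cancel₀ (by linarith), one_smul]
  refine ⟨c⁻¹ • b, ?_, by simp [smul_smul, hc0]⟩
  rw [hbe, smul_add, smul_smul, smul_smul]
  have hci : ‖c⁻¹‖ * (a * a') ≤ 1 := by
    rw [norm_inv, inv_mul_le_one₀ (norm_pos_iff.2 hc0)]
    exact hc
  refine hV₁V _ (hV₂V (hV₂.smul_mem ?_ hv)).1 _ (hV₂V (hV₂.smul_mem ?_ hv')).1
  · rw [norm_mul, Real.norm_of_nonneg (by linarith : (0 : ℝ) ≤ a)]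
    refine le_trans ?_ hci
    gcongr
    nlinarith
  · rwa [norm_mul, Real.norm_of_nonneg (by positivity : (0 : ℝ) ≤ a * a')]

variable [UniformSpace Z] [IsUniformAddGroup Z] [ContinuousSMul ℝ Z]

/-- With the seminorm pulled back along `e`, the hypothesis `hL` makes `L` continuous, so it extends
along the dense map `e`; the identity `q ∘ S = id` passes to the closure. -/
theorem exists_section_of_isVonNBounded [T2Space Z] [CompleteSpace Z] {q : Z →L[ℝ] W}
    {P : Type*} [AddCommGroup P] [Module ℝ P] (e : P →ₗ[ℝ] W) (he : DenseRange e)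
    (L : P →ₗ[ℝ] Z) (hqL : ∀ p, q (L p) = e p)
    (hL : IsVonNBounded ℝ (L '' {p | ‖e p‖ ≤ 1})) : ∃ S : W →L[ℝ] Z, ∀ w, q (S w) = w := by
  let : SeminormedAddCommGroup P := SeminormedAddCommGroup.induced P W e
  let : NormedSpace ℝ P := NormedSpace.induced ℝ P W e
  have hnorm : ∀ p : P, ‖p‖ = ‖e p‖ := fun _ => rfl
  let e' : P →L[ℝ] W := ⟨e, (continuous_induced_dom : Continuous e)⟩
  have he' : IsUniformInducing e' := ⟨rfl⟩
  let L' : P →L[ℝ] Z := L.clmOfExistsBoundedImage ⟨Metric.closedBall 0 1,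
    Metric.closedBall_mem_nhds _ one_pos, by
      convert hL using 2
      ext p
      simp [hnorm]⟩
  refine ⟨L'.extend e', fun w => ?_⟩
  refine he.induction_on w (isClosed_eq (by fun_prop) continuous_id) fun p => ?_
  have : L'.extend e' (e p) = L p := L'.extend_eq (e := e') he he' p
  rw [this, hqL]

/-- A bounded additive set function into the quotient lifts to a bounded additive set function. -/
theorem HasSVMProperty.exists_lift {κ : Cardinal.{u}} {X : Type v} [NormedAddCommGroup X]
    [NormedSpace ℝ X]
    (hX : HasSVMProperty κ X) {i : X →L[ℝ] Z} (hi : IsInducing i)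
    {q : Z →L[ℝ] W} (hq : IsOpenMap q) (hiq : ∀ z, q z = 0 ↔ ∃ x, i x = z)
    {Ω : Type u} {F : Set (Set Ω)} (hF : MeasureTheory.IsSetAlgebra F) (hκ : #F < κ)
    {φ : Set Ω → W} (hφ : IsVectorMeasureOn F φ) (hφ1 : ∀ A, ‖φ A‖ ≤ 1) :
    ∃ L : Set Ω → Z, (∀ A ∈ F, ∀ B ∈ F, Disjoint A B → L (A ∪ B) = L A + L B) ∧ (∀ A, q (L A) = φ A) ∧
      IsVonNBounded ℝ (L '' F) := by
  obtain ⟨B, hB, hB0, hBb⟩ := exists_balanced_isVonNBounded_nhds hi hq fun z hz => (hiq z).1 hz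
  have hsurj : Function.Surjective q := by
    have h : (q : Z →ₗ[ℝ] W).range = ⊤ := Submodule.eq_top_of_nonempty_interior' _
      ⟨0, mem_interior_iff_mem_nhds.2 (by
        have := hq.image_mem_nhds (univ_mem : Set.univ ∈ 𝓝 (0 : Z))
        rw [map_zero, Set.image_univ] at this
        exact this)⟩
    exact LinearMap.range_eq_top.1 h
  obtain ⟨ℓ, hℓ⟩ := (q : Z →ₗ[ℝ] W).exists_rightInverse_of_surjective
    (LinearMap.range_eq_top.2 hsurj)
  have hℓ' : ∀ w, q (ℓ w) = w := fun w => LinearMap.congr_fun hℓ w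
  have hqB : q '' B ∈ 𝓝 (0 : W) := by
    have := hq.image_mem_nhds hB0
    rwa [map_zero] at this
  obtain ⟨r, hr0, hr⟩ := (NormedSpace.isVonNBounded_closedBall ℝ W 1 hqB).exists_pos
  have hlift : ∀ A, ∃ z ∈ r • B, q z = φ A := fun A => by
    obtain ⟨_, ⟨b, hb, rfl⟩, hbA⟩ := hr r (le_abs_self r) (show φ A ∈ _ by simpa using hφ1 A)
    exact ⟨r • b, ⟨b, hb, rfl⟩, by simpa using hbA⟩
  choose s hsB hs using hlift
  have hrB : IsVonNBounded ℝ (r • B) :=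
    hBb.image (r • ContinuousLinearMap.id ℝ Z)
  have hx : ∀ A, ∃ x, i x = s A - ℓ (φ A) := fun A => (hiq _).1 (by rw [map_sub, hs, hℓ', sub_self])
  choose x hx using hx
  -- The additive part `ℓ ∘ φ` drops out of the defect of `x`, leaving `s (A ∪ A') - s A - s A'`, a
  -- member of `r • B - r • B - r • B`.
  have hbd := NormedSpace.isVonNBounded_iff ℝ |>.1
    (((hrB.sub hrB).sub hrB).preimage_of_isInducing hi)
  obtain ⟨K, hK0, hK⟩ := hbd.exists_pos_norm_le
  obtain ⟨c, hc⟩ := hX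
  obtain ⟨μ, hμ, hμc⟩ := hc Ω F hF hκ (fun A => K⁻¹ • x A) fun A hA A' hA' hd => by
    rw [← smul_sub, ← smul_sub, norm_smul, norm_inv, Real.norm_of_nonneg hK0.le,
      inv_mul_le_one₀ hK0]
    refine hK _ ?_
    rw [Set.mem_preimage, map_sub, map_sub, hx, hx, hx, hφ A hA A' hA' hd, map_add]
    refine ⟨s (A ∪ A') - s A, ⟨_, hsB _, _, hsB _, rfl⟩, s A', hsB _, ?_⟩
    simp only
    abel
  refine ⟨fun A => ℓ (φ A) + i (K • μ A), fun A hA A' hA' hd => ?_, fun A => ?_, ?_⟩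
  · simp only [hφ A hA A' hA' hd, hμ A hA A' hA' hd, map_add, smul_add]
    abel
  · rw [map_add, hℓ', (hiq _).2 ⟨_, rfl⟩, add_zero]
  -- The lift equals `s A + i (K • μ A - x A)`, a bounded perturbation of the bounded lift.
  · refine (hrB.add ((NormedSpace.isVonNBounded_closedBall ℝ X (K * c)).image i)).subset ?_
    rintro _ ⟨A, hA, rfl⟩
    refine ⟨s A, hsB A, _, ⟨K • μ A - x A, ?_, rfl⟩, ?_⟩
    · have := hμc A hA
      rw [mem_closedBall_zero_iff, show K • μ A - x A = -(K • (K⁻¹ • x A - μ A)) by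
        rw [smul_sub, smul_smul, mul_inv_cancel₀ hK0.ne', one_smul, neg_sub], norm_neg, norm_smul,
        Real.norm_of_nonneg hK0.le]
      gcongr
    · simp only
      rw [map_sub, hx]
      abel

end Extensions

/-! ### Splitting from a continuous section. -/

section Splitting

variable {X : Type*} [NormedAddCommGroup X] [NormedSpace ℝ X]
  {W : Type*} [NormedAddCommGroup W] [NormedSpace ℝ W]
  {Z : Type*} [AddCommGroup Z] [Module ℝ Z]

theorem exists_isVonNBounded_sum_smul_mem [TopologicalSpace Z] [IsTopologicalAddGroup Z]
    [ContinuousSMul ℝ Z] {i : X →L[ℝ] Z} (hi : IsInducing i) {q : Z →L[ℝ] W} (hq : IsOpenMap q)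
    (hiq : ∀ z, q z = 0 → ∃ x, i x = z) {S : Set Z} (hS : IsVonNBounded ℝ S) :
    ∃ T : Set Z, IsVonNBounded ℝ T ∧
      ∀ (I : Type v) (s : Finset I) (z : I → Z) (c : I → ℝ),
        (∀ J ⊆ s, ∑ i ∈ J, z i ∈ S) → (∀ i ∈ s, |c i| ≤ 1) → ∑ i ∈ s, c i • z i ∈ T := by
  obtain ⟨B, hB, hB0, hBb⟩ := exists_balanced_isVonNBounded_nhds hi hq hiq
  obtain ⟨r, hr0, hr⟩ := (hS hB0).exists_pos
  have hrBb : IsVonNBounded ℝ (r • B) := hBb.image (r • ContinuousLinearMap.id ℝ Z)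
  have hrB0 : r • B ∈ 𝓝 (0 : Z) := (set_smul_mem_nhds_zero_iff hr0.ne').2 hB0
  obtain ⟨K, hK⟩ := exists_sum_smul_mem_smul (hB.smul r) hrB0 hrBb
  exact ⟨K • r • B, hrBb.image (K • ContinuousLinearMap.id ℝ Z), fun I s z c hz hc =>
    hK I s z c (fun J hJ => hr r (le_abs_self r) (hz J hJ)) hc⟩

section Quotient

variable [UniformSpace Z] (N : Submodule ℝ Z)
  (j : X ≃L[ℝ] N) (e : (Z ⧸ N) ≃L[ℝ] W)

theorem isInducing_subtypeL_comp : IsInducing (N.subtypeL ∘L (j : X →L[ℝ] N)) :=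
  IsInducing.subtypeVal.comp j.toHomeomorph.isInducing

theorem isOpenMap_comp_mkQL [IsUniformAddGroup Z] : IsOpenMap ((e : (Z ⧸ N) →L[ℝ] W) ∘L N.mkQL) :=
  e.toHomeomorph.isOpenMap.comp N.isOpenMap_mkQ

theorem comp_mkQL_eq_zero_iff (z : Z) :
    ((e : (Z ⧸ N) →L[ℝ] W) ∘L N.mkQL) z = 0 ↔ ∃ x, (N.subtypeL ∘L (j : X →L[ℝ] N)) x = z := by
  have h : ((e : (Z ⧸ N) →L[ℝ] W) ∘L N.mkQL) z = 0 ↔ z ∈ N := by simp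
  rw [h]
  exact ⟨fun hz => ⟨j.symm ⟨z, hz⟩, by simp⟩, fun ⟨x, hx⟩ => hx ▸ (j x).2⟩

/-- A continuous linear section of the quotient map splits the sequence. -/
theorem sequenceSplits_of_section [IsUniformAddGroup Z] [ContinuousSMul ℝ Z] (S : W →L[ℝ] Z)
    (hS : ∀ w, ((e : (Z ⧸ N) →L[ℝ] W) ∘L N.mkQL) (S w) = w) :
    SequenceSplits (N.subtypeL ∘L (j : X →L[ℝ] N)) ((e : (Z ⧸ N) →L[ℝ] W) ∘L N.mkQL) := by
  set q := (e : (Z ⧸ N) →L[ℝ] W) ∘L N.mkQL with hq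
  have hN : ∀ z, z - S (q z) ∈ N := fun z => by
    have : q (z - S (q z)) = 0 := by rw [map_sub, hS, sub_self]
    obtain ⟨x, hx⟩ := (comp_mkQL_eq_zero_iff N j e _).1 this
    exact hx ▸ (j x).2
  have hqj : ∀ x, q (j x) = 0 := fun x => by simp [hq]
  let π : Z →L[ℝ] N := (ContinuousLinearMap.id ℝ Z - S ∘L q).codRestrict N hN
  have hπ : ∀ z, (π z : Z) = z - S (q z) := fun _ => rfl
  let T : Z →L[ℝ] X × W := ((j.symm : N →L[ℝ] X) ∘L π).prod q
  let T' : X × W →L[ℝ] Z := (N.subtypeL ∘L (j : X →L[ℝ] N)).coprod S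
  have h1 : Function.LeftInverse T' T := fun z => by
    simp [T, T', hπ]
  have h2 : Function.RightInverse T' T := fun ⟨x, w⟩ => by
    have h₁ : π ((j x : Z) + S w) = j x := Subtype.ext (by rw [hπ, map_add, hqj, hS]; simp)
    have h₂ : q ((j x : Z) + S w) = w := by rw [map_add, hqj, hS, zero_add]
    exact Prod.ext ((congr_arg j.symm h₁).trans (j.symm_apply_apply x)) h₂
  refine ⟨ContinuousLinearEquiv.equivOfInverse T T' h1 h2, fun x => h2 (x, 0) ▸ ?_, fun z => rfl⟩
  simp [T']

end Quotient

/-- Any linear section is continuous on a finite-dimensional normed space. This settles `c₀(Γ)` for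
finite `Γ`. -/
theorem PairSplits.of_finiteDimensional [FiniteDimensional ℝ W] : PairSplits.{_, _, w} W X := by
  intro Z _ _ _ _ N j e
  have hsurj : Function.Surjective ((e : (Z ⧸ N) →L[ℝ] W) ∘L N.mkQL) :=
    e.surjective.comp N.mkQ_surjective
  obtain ⟨ℓ, hℓ⟩ := ((e : (Z ⧸ N) →L[ℝ] W) ∘L N.mkQL).toLinearMap.exists_rightInverse_of_surjective
    (LinearMap.range_eq_top.2 hsurj)
  exact sequenceSplits_of_section N j e ℓ.toContinuousLinearMap fun w => LinearMap.congr_fun hℓ w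

end Splitting

/-! ### Additive set functions and atoms. -/

section SetFunctions

variable {Ω : Type*} {F : Set (Set Ω)} {Z : Type*} [AddCommGroup Z] {L : Set Ω → Z}

theorem isSetAlgebra_univ : MeasureTheory.IsSetAlgebra (Set.univ : Set (Set Ω)) :=
  ⟨trivial, fun _ _ => trivial, fun _ _ _ _ => trivial⟩

theorem additive_preimage_finset (hF : MeasureTheory.IsSetAlgebra F)
    (hL : ∀ A ∈ F, ∀ B ∈ F, Disjoint A B → L (A ∪ B) = L A + L B) {ι : Type*} (t : Ω → ι)
    (ht : ∀ j, t ⁻¹' {j} ∈ F) (S : Finset ι) :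
    t ⁻¹' S ∈ F ∧ L (t ⁻¹' S) = ∑ j ∈ S, L (t ⁻¹' {j}) := by
  classical
  induction S using Finset.induction_on with
  | empty =>
    have := hL ∅ hF.empty_mem ∅ hF.empty_mem (Set.disjoint_empty _)
    simp only [Set.union_empty, left_eq_add] at this
    simpa using ⟨hF.empty_mem, this⟩
  | insert a S ha ih =>
    rw [Finset.sum_insert ha, Finset.coe_insert, Set.insert_eq, Set.preimage_union, ← ih.2]
    refine ⟨hF.union_mem (ht a) ih.1, hL _ (ht a) _ ih.1 (Disjoint.preimage _ ?_)⟩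
    simpa using ha

/-- A linear combination of values of an additive set function, in terms of the atoms of the
algebra generated by the sets involved. -/
theorem linearCombination_eq_sum_atoms [Module ℝ Z]
    (hL : ∀ A B, Disjoint A B → L (A ∪ B) = L A + L B) (p : Set Ω →₀ ℝ) :
    ∃ (t : Ω → Finset (Set Ω)) (s : Finset (Finset (Set Ω))) (c : Finset (Set Ω) → ℝ),
      Finsupp.linearCombination ℝ L p = ∑ J ∈ s, c J • L (t ⁻¹' {J}) ∧
      ∀ J ∈ s, c J ≠ 0 → ∃ ω, c J = Finsupp.linearCombination ℝ (fun A => A.indicator 1 ω) p := by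
  classical
  let t : Ω → Finset (Set Ω) := fun ω => p.support.filter (ω ∈ ·)
  have hatoms := fun S => (additive_preimage_finset isSetAlgebra_univ (fun A _ B _ => hL A B) t
    (fun _ => trivial) S).2
  -- Empty atoms get coefficient `0`, so that every nonzero coefficient is a value of the simple
  -- function and is bounded by its sup norm.
  refine ⟨t, p.support.powerset,
    fun J => if (t ⁻¹' {J}).Nonempty then ∑ A ∈ p.support with A ∈ J, p A else 0, ?_, ?_⟩
  · have h0 : L ∅ = 0 := by simpa using hatoms ∅
    have hA : ∀ A ∈ p.support, L A = ∑ J ∈ p.support.powerset with A ∈ J, L (t ⁻¹' {J}) := by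
      intro A hA
      rw [← hatoms]
      congr 1
      ext ω
      simp [t, Finsupp.mem_support_iff.1 hA]
    have hc : ∀ J, (if (t ⁻¹' {J}).Nonempty then ∑ A ∈ p.support with A ∈ J, p A else 0) •
        L (t ⁻¹' {J}) = ∑ A ∈ p.support with A ∈ J, p A • L (t ⁻¹' {J}) := by
      intro J
      split_ifs with h
      · rw [Finset.sum_smul]
      · rw [Set.not_nonempty_iff_eq_empty.1 h]
        simp [h0]
    simp_rw [hc, Finset.sum_filter]
    rw [Finset.sum_comm, Finsupp.linearCombination_apply, Finsupp.sum]
    refine Finset.sum_congr rfl fun A hAs => ?_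
    rw [← Finset.sum_filter, ← Finset.smul_sum, ← hA A hAs]
  · intro J _ hJ
    simp only [ne_eq, ite_eq_right_iff, Classical.not_imp] at hJ
    obtain ⟨⟨ω, hω⟩, -⟩ := hJ
    refine ⟨ω, ?_⟩
    simp only [show (t ⁻¹' {J}).Nonempty from ⟨ω, hω⟩, if_true]
    rw [Finsupp.linearCombination_apply, Finsupp.sum, Finset.sum_filter]
    refine Finset.sum_congr rfl fun A hA => ?_
    have : A ∈ J ↔ ω ∈ A := by
      rw [← (hω : t ω = J)]
      simp only [t, Finset.mem_filter, hA, true_and]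
    simp [this, Set.indicator_apply]

end SetFunctions

/-! ### The case of `ℓ_∞(Γ)`. -/

section BoundedFunctions

/-- The indicator function of `A` as an element of `ℓ_∞(Γ)`. -/
noncomputable def lpIndicator {Γ : Type*} (A : Set Γ) : lp (fun _ : Γ => ℝ) ⊤ :=
  ⟨A.indicator 1, memℓp_infty ⟨1, by
    rintro _ ⟨γ, rfl⟩
    by_cases h : γ ∈ A <;> simp [h]⟩⟩

theorem lpIndicator_apply {Γ : Type*} (A : Set Γ) (γ : Γ) :
    lpIndicator A γ = A.indicator 1 γ := rfl

theorem norm_lpIndicator_le {Γ : Type*} (A : Set Γ) : ‖lpIndicator A‖ ≤ 1 :=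
  lp.norm_le_of_forall_le zero_le_one fun γ => by
    by_cases h : γ ∈ A <;> simp [lpIndicator_apply, h]

theorem lpIndicator_union {Γ : Type*} {A B : Set Γ} (h : Disjoint A B) :
    lpIndicator (A ∪ B) = lpIndicator A + lpIndicator B := by
  ext γ
  exact congr_fun (Set.indicator_union_of_disjoint h 1) γ

theorem linearCombination_lpIndicator_apply {Γ : Type*} (p : Set Γ →₀ ℝ) (γ : Γ) :
    Finsupp.linearCombination ℝ lpIndicator p γ =
      Finsupp.linearCombination ℝ (fun A : Set Γ => A.indicator (1 : Γ → ℝ) γ) p := by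
  simp only [Finsupp.linearCombination_apply, Finsupp.sum]
  rw [lp.coeFn_sum, Finset.sum_apply]
  rfl

theorem denseRange_linearCombination_lpIndicator (Γ : Type*) :
    DenseRange (Finsupp.linearCombination ℝ (lpIndicator (Γ := Γ))) := by
  intro f
  rw [Metric.mem_closure_iff]
  intro ε hε
  obtain ⟨M, hM⟩ := exists_nat_ge (‖f‖ / (ε / 2))
  -- Rounding `f` down to multiples of `ε / 2` gives a simple function, as `f` is bounded.
  let k : Γ → ℤ := fun γ => ⌊f γ / (ε / 2)⌋
  refine ⟨_, ⟨∑ m ∈ Finset.Icc (-(M : ℤ) - 1) M, Finsupp.single (k ⁻¹' {m}) (ε / 2 * m), rfl⟩, ?_⟩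
  rw [dist_eq_norm]
  refine (lp.norm_le_of_forall_le (half_pos hε).le fun γ => ?_).trans_lt (half_lt_self hε)
  have hfγ : |f γ / (ε / 2)| ≤ M := by
    rw [abs_div, abs_of_pos (half_pos hε)]
    exact (div_le_div_of_nonneg_right (lp.norm_apply_le_norm (by simp) f γ)
      (half_pos hε).le).trans hM
  have hk : k γ ∈ Finset.Icc (-(M : ℤ) - 1) M := by
    have h := abs_le.1 hfγ
    rw [Finset.mem_Icc]
    refine ⟨Int.le_floor.2 ?_, Int.cast_le (R := ℝ).1 ((Int.floor_le _).trans ?_)⟩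
    · push_cast; linarith
    · push_cast; linarith
  rw [lp.coeFn_sub, Pi.sub_apply, map_sum, lp.coeFn_sum, Finset.sum_apply,
    Finset.sum_eq_single_of_mem _ hk]
  · rw [Finsupp.linearCombination_single, lp.coeFn_smul, Pi.smul_apply, lpIndicator_apply,
      Set.indicator_of_mem (by simp)]
    have h1 := Int.floor_le (f γ / (ε / 2))
    have h2 := (Int.lt_floor_add_one (f γ / (ε / 2))).le
    rw [le_div_iff₀ (half_pos hε)] at h1
    rw [div_le_iff₀ (half_pos hε)] at h2
    simp only [Pi.one_apply, smul_eq_mul, mul_one, Real.norm_eq_abs, k]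
    rw [abs_le]
    constructor <;> linarith
  · intro m _ hm
    rw [Finsupp.linearCombination_single, lp.coeFn_smul, Pi.smul_apply, lpIndicator_apply,
      Set.indicator_of_notMem (by simpa using hm.symm), smul_zero]

theorem HasSVMProperty.pairSplits_lp_top (Γ : Type u) (X : Type v) [NormedAddCommGroup X]
    [NormedSpace ℝ X] (hX : HasSVMProperty (Order.succ ((2 : Cardinal.{u}) ^ #Γ)) X) :
    PairSplits.{u, v, w} (lp (fun _ : Γ => ℝ) ⊤) X := by
  intro Z _ _ _ _ N j e
  have hi := isInducing_subtypeL_comp N j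
  have hq := isOpenMap_comp_mkQL N e
  have hiq := comp_mkQL_eq_zero_iff N j e
  obtain ⟨L, hL, hqL, hLb⟩ := hX.exists_lift hi hq hiq isSetAlgebra_univ
    (by rw [mk_univ, mk_set]; exact Order.lt_succ _) (φ := lpIndicator)
    (fun A _ B _ h => lpIndicator_union h) norm_lpIndicator_le
  obtain ⟨T, hT, hTL⟩ := exists_isVonNBounded_sum_smul_mem hi hq (fun z => (hiq z).1) hLb
  have hL' : ∀ A B, Disjoint A B → L (A ∪ B) = L A + L B := fun A B => hL A trivial B trivial
  obtain ⟨S, hS⟩ := exists_section_of_isVonNBounded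
    (Finsupp.linearCombination ℝ (lpIndicator (Γ := Γ)))
    (denseRange_linearCombination_lpIndicator Γ) (Finsupp.linearCombination ℝ L)
    (q := (e : (Z ⧸ N) →L[ℝ] lp (fun _ : Γ => ℝ) ⊤) ∘L N.mkQL)
    (fun p => by
      simp only [Finsupp.linearCombination_apply, Finsupp.sum, map_sum, map_smul, hqL])
    (hT.subset <| by
      rintro _ ⟨p, hp, rfl⟩
      obtain ⟨t, s, c, hpe, hc⟩ := linearCombination_eq_sum_atoms hL' p
      rw [hpe]
      refine hTL _ s _ c (fun J _ => ⟨t ⁻¹' J, trivial, ?_⟩) fun J hJ => ?_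
      · exact (additive_preimage_finset isSetAlgebra_univ hL t (fun _ => trivial) J).2
      · by_cases h0 : c J = 0
        · simp [h0]
        obtain ⟨γ, hγ⟩ := hc J hJ h0
        rw [hγ, ← linearCombination_lpIndicator_apply]
        exact (lp.norm_apply_le_norm (by simp) _ γ).trans hp)
  exact sequenceSplits_of_section N j e S hS

end BoundedFunctions

/-! ### The case of `c₀(Γ)`. -/

section NullFunctions

/-- The indicator function of `A` if `A` is finite, and `0` otherwise. -/
noncomputable def finiteIndicator {Γ : Type*} (A : Set Γ) : Γ →₀ ℝ :=
  open scoped Classical in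
  if h : A.Finite then Finsupp.indicator h.toFinset fun _ _ => 1 else 0

theorem finiteIndicator_apply {Γ : Type*} {A : Set Γ} (h : A.Finite) (γ : Γ) :
    finiteIndicator A γ = A.indicator 1 γ := by
  classical
  rw [finiteIndicator, dif_pos h, Finsupp.indicator_apply, Set.indicator_apply]
  simp

theorem finiteIndicator_of_infinite {Γ : Type*} {A : Set Γ} (h : A.Infinite) : finiteIndicator A = 0 :=
  dif_neg h

variable {Γ : Type u} [TopologicalSpace Γ]

/-- Finitely supported functions as elements of `c₀(Γ)`. -/
noncomputable def finsuppToC₀ (Γ : Type u) [TopologicalSpace Γ] [DiscreteTopology Γ] :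
    (Γ →₀ ℝ) →ₗ[ℝ] C₀(Γ, ℝ) where
  toFun p := ⟨⟨p, continuous_of_discreteTopology⟩, by
    rw [cocompact_eq_cofinite]
    refine tendsto_const_nhds.congr' ?_
    filter_upwards [p.hasFiniteSupport.compl_mem_cofinite] with γ hγ
    simpa [eq_comm] using hγ⟩
  map_add' _ _ := rfl
  map_smul' _ _ := rfl

theorem finsuppToC₀_apply [DiscreteTopology Γ] (p : Γ →₀ ℝ) (γ : Γ) : finsuppToC₀ Γ p γ = p γ := rfl

theorem ZeroAtInftyContinuousMap.norm_le_iff (f : C₀(Γ, ℝ)) {C : ℝ} (hC : 0 ≤ C) :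
    ‖f‖ ≤ C ↔ ∀ γ, |f γ| ≤ C := by
  rw [← ZeroAtInftyContinuousMap.norm_toBCF_eq_norm, BoundedContinuousFunction.norm_le hC]
  rfl

theorem denseRange_finsuppToC₀ [DiscreteTopology Γ] : DenseRange (finsuppToC₀ Γ) := by
  classical
  intro f
  rw [Metric.mem_closure_iff]
  intro ε hε
  have hfin : {γ | ε / 2 ≤ |f γ|}.Finite := by
    have h := f.zero_at_infty'
    rw [cocompact_eq_cofinite] at h
    have h := h.eventually (Metric.ball_mem_nhds 0 (half_pos hε))
    refine (eventually_cofinite.1 h).subset fun γ hγ => ?_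
    simpa using hγ
  refine ⟨_, ⟨Finsupp.indicator hfin.toFinset fun γ _ => f γ, rfl⟩, ?_⟩
  rw [dist_eq_norm]
  refine lt_of_le_of_lt ((ZeroAtInftyContinuousMap.norm_le_iff _ (half_pos hε).le).2 fun γ => ?_)
    (half_lt_self hε)
  rw [ZeroAtInftyContinuousMap.sub_apply, finsuppToC₀_apply, Finsupp.indicator_apply]
  split_ifs with h
  · simpa using (half_pos hε).le
  · simp only [Set.Finite.mem_toFinset, Set.mem_ofPred_eq, not_le] at h
    simpa using h.le

theorem isSetAlgebra_finite_or_cofinite (Γ : Type*) :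
    MeasureTheory.IsSetAlgebra {A : Set Γ | A.Finite ∨ Aᶜ.Finite} where
  empty_mem := Or.inl Set.finite_empty
  compl_mem A hA := by
    simpa only [Set.mem_ofPred_eq, compl_compl, or_comm] using hA
  union_mem A B hA hB := by
    rcases hA with hA | hA
    · rcases hB with hB | hB
      · exact Or.inl (hA.union hB)
      · exact Or.inr (hB.subset (Set.compl_subset_compl.2 Set.subset_union_right))
    · exact Or.inr (hA.subset (Set.compl_subset_compl.2 Set.subset_union_left))

theorem mk_finite_or_cofinite_le (Γ : Type u) [Infinite Γ] :
    #{A : Set Γ | A.Finite ∨ Aᶜ.Finite} ≤ #Γ := by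
  have h : {A : Set Γ | A.Finite ∨ Aᶜ.Finite} ⊆
      Set.range (fun s : Finset Γ => (s : Set Γ)) ∪ Set.range fun s : Finset Γ => (s : Set Γ)ᶜ := by
    rintro A (hA | hA)
    · exact Or.inl ⟨hA.toFinset, by simp⟩
    · exact Or.inr ⟨hA.toFinset, by simp⟩
  calc #{A : Set Γ | A.Finite ∨ Aᶜ.Finite} ≤ _ := mk_le_mk_of_subset h
    _ ≤ _ := mk_union_le _ _
    _ ≤ #(Finset Γ) + #(Finset Γ) := add_le_add mk_range_le mk_range_le
    _ = #Γ := by rw [mk_finset_of_infinite, add_eq_self (aleph0_le_mk Γ)]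

/-- The additive extension of `A ↦ 1_A` from the finite sets to the finite and cofinite ones that
vanishes on the whole space. -/
noncomputable def c₀Indicator [DiscreteTopology Γ] (A : Set Γ) : C₀(Γ, ℝ) :=
  finsuppToC₀ Γ (finiteIndicator A - finiteIndicator Aᶜ)

theorem norm_c₀Indicator_le [DiscreteTopology Γ] [Infinite Γ] (A : Set Γ) : ‖c₀Indicator A‖ ≤ 1 := by
  refine (ZeroAtInftyContinuousMap.norm_le_iff _ zero_le_one).2 fun γ => ?_
  rw [c₀Indicator, finsuppToC₀_apply, Finsupp.sub_apply]
  have hle : ∀ B : Set Γ, |finiteIndicator B γ| ≤ 1 := fun B => by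
    by_cases hB : B.Finite
    · by_cases h : γ ∈ B <;> simp [finiteIndicator_apply hB, h]
    · simp [finiteIndicator_of_infinite hB]
  -- As `Γ` is infinite, `A` and `Aᶜ` are not both finite, so at most one of the two terms survives.
  by_cases hA : A.Finite
  · simpa [finiteIndicator_of_infinite hA.infinite_compl] using hle A
  · simpa [finiteIndicator_of_infinite hA] using hle Aᶜ

theorem c₀Indicator_union [DiscreteTopology Γ] [Infinite Γ] :
    IsVectorMeasureOn {A : Set Γ | A.Finite ∨ Aᶜ.Finite} c₀Indicator := by
  have key : ∀ A B : Set Γ, A.Finite → B.Finite ∨ Bᶜ.Finite → Disjoint A B →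
      (c₀Indicator (A ∪ B) : C₀(Γ, ℝ)) = c₀Indicator A + c₀Indicator B := by
    intro A B hA hB hd
    rw [c₀Indicator, c₀Indicator, c₀Indicator, ← map_add]
    congr 1
    rw [finiteIndicator_of_infinite hA.infinite_compl]
    rcases hB with hB | hB
    · rw [finiteIndicator_of_infinite (hA.union hB).infinite_compl,
        finiteIndicator_of_infinite hB.infinite_compl]
      ext γ
      simp only [sub_zero, Finsupp.add_apply, finiteIndicator_apply (hA.union hB),
        finiteIndicator_apply hA, finiteIndicator_apply hB]
      exact congr_fun (Set.indicator_union_of_disjoint hd 1) γ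
    · have hB' : B.Infinite := by simpa using hB.infinite_compl
      have hAB : (A ∪ B)ᶜ.Finite := hB.subset (Set.compl_subset_compl.2 Set.subset_union_right)
      rw [finiteIndicator_of_infinite hB',
        finiteIndicator_of_infinite (hB'.mono Set.subset_union_right)]
      ext γ
      simp only [zero_sub, sub_zero, Finsupp.add_apply, Finsupp.neg_apply,
        finiteIndicator_apply hAB, finiteIndicator_apply hA, finiteIndicator_apply hB]
      have hdγ : γ ∈ A → γ ∉ B := fun h => Set.disjoint_left.1 hd h
      by_cases h1 : γ ∈ A <;> by_cases h2 : γ ∈ B <;> simp_all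
  intro A hA B hB hd
  rcases hA with hA | hA
  · exact key A B hA hB hd
  rcases hB with hB | hB
  · rw [Set.union_comm, add_comm]
    exact key B A hB (Or.inr hA) hd.symm
  · exact absurd (hB.subset hd.subset_compl_right) (by simpa using hA.infinite_compl)

theorem c₀Indicator_singleton [DiscreteTopology Γ] [Infinite Γ] (γ : Γ) :
    c₀Indicator {γ} = finsuppToC₀ Γ (Finsupp.single γ 1) := by
  classical
  rw [c₀Indicator, finiteIndicator_of_infinite (Set.finite_singleton γ).infinite_compl, sub_zero]
  congr 1
  ext x
  rw [finiteIndicator_apply (Set.finite_singleton γ), Finsupp.single_apply, Set.indicator_apply]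
  simp [eq_comm]

theorem HasSVMProperty.pairSplits_c₀ [DiscreteTopology Γ] [Infinite Γ] (X : Type v) [NormedAddCommGroup X]
    [NormedSpace ℝ X] (hX : HasSVMProperty (Order.succ #Γ) X) :
    PairSplits.{u, v, w} C₀(Γ, ℝ) X := by
  intro Z _ _ _ _ N j e
  have hi := isInducing_subtypeL_comp N j
  have hq := isOpenMap_comp_mkQL N e
  have hiq := comp_mkQL_eq_zero_iff N j e
  have hF := isSetAlgebra_finite_or_cofinite Γ
  obtain ⟨L, hL, hqL, hLb⟩ := hX.exists_lift hi hq hiq hF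
    (Order.lt_succ_of_le (mk_finite_or_cofinite_le Γ)) c₀Indicator_union norm_c₀Indicator_le
  obtain ⟨T, hT, hTL⟩ := exists_isVonNBounded_sum_smul_mem hi hq (fun z => (hiq z).1) hLb
  obtain ⟨S, hS⟩ := exists_section_of_isVonNBounded (finsuppToC₀ Γ) denseRange_finsuppToC₀
    (Finsupp.linearCombination ℝ fun γ => L {γ})
    (q := (e : (Z ⧸ N) →L[ℝ] C₀(Γ, ℝ)) ∘L N.mkQL)
    (fun p => by
      conv_rhs => rw [← p.sum_single, Finsupp.sum, map_sum]
      rw [Finsupp.linearCombination_apply, Finsupp.sum, map_sum]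
      refine Finset.sum_congr rfl fun γ _ => ?_
      rw [map_smul, hqL, c₀Indicator_singleton, ← map_smul, Finsupp.smul_single_one])
    (hT.subset <| by
      rintro _ ⟨p, hp, rfl⟩
      rw [Finsupp.linearCombination_apply]
      refine hTL _ p.support _ p (fun J _ => ⟨J, ?_⟩) fun γ _ =>
        (ZeroAtInftyContinuousMap.norm_le_iff _ zero_le_one).1 hp γ
      simpa only [Set.preimage_id] using additive_preimage_finset hF hL id
        (fun γ => Or.inl (Set.finite_singleton γ)) J)
  exact sequenceSplits_of_section N j e S hS

end NullFunctions

theorem theorem4p2 (Γ : Type u) [TopologicalSpace Γ] [DiscreteTopology Γ]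
    (X : Type v) [NormedAddCommGroup X] [NormedSpace ℝ X] [CompleteSpace X] :
    (HasSVMProperty (Order.succ ((2 : Cardinal.{u}) ^ #Γ)) X →
      PairSplits.{u, v, w} (lp (fun _ : Γ => ℝ) ⊤) X) ∧
    (HasSVMProperty (Order.succ #Γ) X → PairSplits.{u, v, w} C₀(Γ, ℝ) X) := by
  refine ⟨HasSVMProperty.pairSplits_lp_top Γ X, fun hX => ?_⟩
  -- The finite-cofinite argument needs `Γ` infinite: otherwise the whole space is finite as well as
  -- cofinite, and the algebra has `2 ^ #Γ` members.
  rcases finite_or_infinite Γ with hΓ | hΓ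
  · let f : C₀(Γ, ℝ) →ₗ[ℝ] Γ → ℝ :=
      { toFun := fun f => f, map_add' := fun _ _ => rfl, map_smul' := fun _ _ => rfl }
    have : FiniteDimensional ℝ C₀(Γ, ℝ) := FiniteDimensional.of_injective f DFunLike.coe_injective
    exact PairSplits.of_finiteDimensional
  · exact hX.pairSplits_c₀ X
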